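/- A single-player extensive-form game is a finite rooted tree with real utilities $u(z)$ at its terminal nodes $z$, whose nonterminal nodes are either chance nodes with given probabilities or decision nodes of the player. The decision nodes are partitioned into information sets $I$, the nodes of $I$ having the same action set $A_I$. A strategy $\mu$ assigns to each $I$ a distribution $\mu(\cdot\mid I)\in\Delta(A_I)$. Let $P(h'\mid\mu,h)$ be the probability of reaching $h'$ from $h$ under $\mu$ ($h$ is omitted if it is the root), $U(\mu\mid h)=\sum_z P(z\mid\mu,h)\,u(z)$, and $U(\mu)$ the ex-ante utility, i.e. $U(\mu\mid h)$ for $h$ the root. Let $\mathrm{Fr}(I\mid\mu)=\sum_{h\in I}P(h\mid\mu)$, and let $P(I\mid\mu)$ be the probability that $I$ is visited at least once. - $\mu$ is ex-ante optimal if it maximizes $U$ over all strategies. - $\mu$ is an (EDT,GDH)-equilibrium if for every $I$ with $P(I\mid\mu)>0$, $\mu(\cdot\mid I)$ maximizes over $\alpha\in\Delta(A_I)$ the value $\sum_{z}\frac{P(z\mid\mu_{I\mapsto\alpha})}{P(I\mid\mu_{I\mapsto\alpha})}u(z)$, the sum being over the terminal nodes $z$ whose history meets $I$, where $\mu_{I\mapsto\alpha}$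 is $\mu$ with $\mu(\cdot\mid I)$ replaced by $\alpha$. - $\mu$ is a (CDT,GT)-equilibrium if for every $I$ with $\mathrm{Fr}(I\mid\mu)>0$, $\mu(\cdot\mid I)$ maximizes over $\alpha\in\Delta(A_I)$ the value $\sum_{a\in A_I}\alpha(a)\sum_{h\in I}\frac{P(h\mid\mu)}{\mathrm{Fr}(I\mid\mu)}\,U(\mu\mid h\circ a)$, where $h\circ a$ is the node reached from $h$ by the action $a$. Consider the following game. At the root, chance selects one of three branches, each with probability $\frac13$. In the three branches the player has up to $6$, up to $2$ and exactly $1$ consecutive decisions, respectively, each between $a_1$ and $a_2$. The action $a_2$ always ends the game with utility $0$, while $a_1$ leads to the next decision node of the branch or, at the last one, ends the game with utility $-16$, $3$ and $3$, respectively. All nine decision nodes form one information set, so a strategy is a pair $(x,y)$ with $x,y\ge 0$, $x+y=1$, where $x$ and $y$ are the probabilities of $a_1$ and $a_2$. This game does not have perfect recall, and its ex-ante utility, as a function on $\mathbb{R}^2$, is $U(x,y)=-\frac{16}{3}x^6+x^2+x$. The equation $x^5-x-1=0$ has exactly one real solution $x^*$, and, with $\tilde x=x^*/2$, the strategy $(\tilde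 x,1-\tilde x)$ is the unique ex-ante optimal strategy, the unique (EDT,GDH)-equilibrium and the unique (CDT,GT)-equilibrium of the game. Both $\tilde x$ and $1-\tilde x$ are irrational and, moreover, cannot be expressed in radicals over $\mathbb{Q}$. -/

import Mathlib

/-- A finite single-player extensive-form game, possibly with imperfect recall and chance moves.
The rooted game tree is given by its finite set `nodes` of histories: a node is identified with the
list of edge labels (actions or chance outcomes) on the path from the root `[]` to it, so the child
of `h` along the edge `a` is `h ++ [a]`, and the edges available at `h` are the `a` with
`h ++ [a] ∈ nodes`. A node is terminal if no edge is available at it. A nonterminal node `h` is a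
chance node if `infoSet h = none`, and a decision node of the player in the information set `i` if
`infoSet h = some i`. The values of `infoSet`, `chanceProb`, `utility` on lists for which they have
no meaning are irrelevant. -/
structure SinglePlayerGame (InfoSet Action : Type) [DecidableEq InfoSet] [Fintype Action]
    [DecidableEq Action] where
  nodes : Finset (List Action)
  root_mem : [] ∈ nodes
  parent_mem : ∀ (h : List Action) (a : Action), h ++ [a] ∈ nodes → h ∈ nodes
  infoSet : List Action → Option InfoSet
  /-- The actions available at an information set. -/
  actions : InfoSet → Finset Action
  /-- All nodes of an information set have the same available actions. -/
  actions_eq : ∀ h ∈ nodes, (∃ a, h ++ [a] ∈ nodes) → ∀ i, infoSet h = some i →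
    ∀ a, a ∈ actions i ↔ h ++ [a] ∈ nodes
  /-- Information sets are nonempty sets of nonterminal nodes. -/
  infoSet_nonempty : ∀ i, ∃ h ∈ nodes, (∃ a, h ++ [a] ∈ nodes) ∧ infoSet h = some i
  chanceProb : List Action → Action → ℝ
  chanceProb_nonneg : ∀ h ∈ nodes, infoSet h = none → ∀ a, h ++ [a] ∈ nodes → 0 ≤ chanceProb h a
  chanceProb_sum : ∀ h ∈ nodes, (∃ a, h ++ [a] ∈ nodes) → infoSet h = none →
    ∑ a with h ++ [a] ∈ nodes, chanceProb h a = 1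
  utility : List Action → ℝ

namespace SinglePlayerGame

variable {InfoSet Action : Type} [DecidableEq InfoSet] [Fintype Action] [DecidableEq Action]

/-- The terminal nodes. -/
def terminals (G : SinglePlayerGame InfoSet Action) : Finset (List Action) :=
  {h ∈ G.nodes | ∀ a, h ++ [a] ∉ G.nodes}

/-- The nonterminal nodes belonging to the information set `i`. -/
def infoNodes (G : SinglePlayerGame InfoSet Action) (i : InfoSet) : Finset (List Action) :=
  {h ∈ G.nodes | (∃ a, h ++ [a] ∈ G.nodes) ∧ G.infoSet h = some i}

/-- `Δ(A_i)`: the probability distributions on the actions available at the information set `i`,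
as functions on all labels that vanish outside `A_i`. -/
def mixedActions (G : SinglePlayerGame InfoSet Action) (i : InfoSet) : Set (Action → ℝ) :=
  {α | (∀ a, 0 ≤ α a) ∧ (∀ a, a ∉ G.actions i → α a = 0) ∧ ∑ a ∈ G.actions i, α a = 1}

/-- The (behavioral) strategies: a choice of a mixed action at every information set. -/
def strategies (G : SinglePlayerGame InfoSet Action) : Set (InfoSet → Action → ℝ) :=
  {μ | ∀ i, μ i ∈ G.mixedActions i}

/-- The probability that the edge `a` is followed at the node `h` under `μ`. -/
def moveProb (G : SinglePlayerGame InfoSet Action) (μ : InfoSet → Action → ℝ)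
    (h : List Action) (a : Action) : ℝ :=
  match G.infoSet h with
  | none => G.chanceProb h a
  | some i => μ i a

/-- The product of the probabilities, under `μ`, of the successive edges `s` followed from the
node `h` on. -/
def pathProb (G : SinglePlayerGame InfoSet Action) (μ : InfoSet → Action → ℝ) :
    List Action → List Action → ℝ
  | _, [] => 1
  | h, a :: s => G.moveProb μ h a * G.pathProb μ (h ++ [a]) s

/-- `P(h' ∣ μ, h)`: the probability of reaching `h'` from `h` under `μ`. It is zero if `h` does not
lie on the path from the root to `h'`. -/
def reachProb (G : SinglePlayerGame InfoSet Action) (μ : InfoSet → Action → ℝ)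
    (h h' : List Action) : ℝ :=
  if h <+: h' then G.pathProb μ h (h'.drop h.length) else 0

/-- `U(μ ∣ h)`: the expected utility under `μ` when play starts at the node `h`. -/
def expectedUtilityFrom (G : SinglePlayerGame InfoSet Action) (μ : InfoSet → Action → ℝ)
    (h : List Action) : ℝ :=
  ∑ z ∈ G.terminals, G.reachProb μ h z * G.utility z

/-- `U(μ)`: the ex-ante expected utility. It makes sense (as a polynomial) for every real vector
`μ`, not only for strategies. -/
def exAnteUtility (G : SinglePlayerGame InfoSet Action) (μ : InfoSet → Action → ℝ) : ℝ :=
  G.expectedUtilityFrom μ []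

/-- An ex-ante optimal strategy. -/
def IsExAnteOptimal (G : SinglePlayerGame InfoSet Action) (μ : InfoSet → Action → ℝ) : Prop :=
  μ ∈ G.strategies ∧ IsMaxOn G.exAnteUtility G.strategies μ

/-! Generalized thirding (GT) and causal decision theory (CDT) -/

/-- `Fr(I ∣ μ)`: the expected number of visits to the information set `i`. -/
def visitFrequency (G : SinglePlayerGame InfoSet Action) (μ : InfoSet → Action → ℝ)
    (i : InfoSet) : ℝ :=
  ∑ h ∈ G.infoNodes i, G.reachProb μ [] h

/-- The GT belief in being at the node `h`, given that one is in the information set `i`. -/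
noncomputable def beliefGT (G : SinglePlayerGame InfoSet Action) (μ : InfoSet → Action → ℝ)
    (h : List Action) (i : InfoSet) : ℝ :=
  if h ∈ G.infoNodes i then G.reachProb μ [] h / G.visitFrequency μ i else 0

/-- The (CDT,GT)-expected utility of the action `a` at `i`: the action is taken at the current node
only, and `μ` is followed everywhere else. -/
noncomputable def actionUtilityCDTGT (G : SinglePlayerGame InfoSet Action)
    (a : Action) (μ : InfoSet → Action → ℝ) (i : InfoSet) : ℝ :=
  ∑ h ∈ G.infoNodes i, G.beliefGT μ h i * G.expectedUtilityFrom μ (h ++ [a])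

/-- The (CDT,GT)-expected utility of the mixed action `α` at `i`. -/
noncomputable def utilityCDTGT (G : SinglePlayerGame InfoSet Action)
    (α : Action → ℝ) (μ : InfoSet → Action → ℝ) (i : InfoSet) : ℝ :=
  ∑ a ∈ G.actions i, α a * G.actionUtilityCDTGT a μ i

/-- A (CDT,GT)-equilibrium: at each information set visited with positive frequency, the mixed
action of the strategy maximizes the (CDT,GT)-expected utility. -/
def IsCDTGTEquilibrium (G : SinglePlayerGame InfoSet Action) (μ : InfoSet → Action → ℝ) : Prop :=
  μ ∈ G.strategies ∧ ∀ i, 0 < G.visitFrequency μ i →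
    IsMaxOn (fun α => G.utilityCDTGT α μ i) (G.mixedActions i) (μ i)

/-! Generalized double halving (GDH) and evidential decision theory (EDT) -/

/-- The nodes of the information set `i` that are not preceded by another node of `i`. -/
def firstNodes (G : SinglePlayerGame InfoSet Action) (i : InfoSet) : Finset (List Action) :=
  {h ∈ G.infoNodes i | ∀ h' ∈ G.infoNodes i, h' <+: h → h' = h}

/-- `P(I ∣ μ)`: the probability of visiting the information set `i` at least once. -/
def infoReachProb (G : SinglePlayerGame InfoSet Action) (μ : InfoSet → Action → ℝ)
    (i : InfoSet) : ℝ :=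
  ∑ h ∈ G.firstNodes i, G.reachProb μ [] h

/-- The GDH belief in the full history of the terminal node `z`, given that one is in the
information set `i`. -/
noncomputable def beliefGDH (G : SinglePlayerGame InfoSet Action) (μ : InfoSet → Action → ℝ)
    (z : List Action) (i : InfoSet) : ℝ :=
  if ∃ h ∈ G.infoNodes i, h <+: z then G.reachProb μ [] z / G.infoReachProb μ i else 0

/-- The (EDT,GDH)-expected utility of the mixed action `α` at `i`: the player considers herself to
use `α` at every visit of `i`, that is, to follow the strategy `μ` with `μ i` replaced by `α`. -/
noncomputable def utilityEDTGDH (G : SinglePlayerGame InfoSet Action)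
    (α : Action → ℝ) (μ : InfoSet → Action → ℝ) (i : InfoSet) : ℝ :=
  ∑ z ∈ G.terminals, G.beliefGDH (Function.update μ i α) z i * G.utility z

/-- An (EDT,GDH)-equilibrium: at each information set reached with positive probability, the mixed
action of the strategy maximizes the (EDT,GDH)-expected utility. -/
def IsEDTGDHEquilibrium (G : SinglePlayerGame InfoSet Action) (μ : InfoSet → Action → ℝ) : Prop :=
  μ ∈ G.strategies ∧ ∀ i, 0 < G.infoReachProb μ i →
    IsMaxOn (fun α => G.utilityEDTGDH α μ i) (G.mixedActions i) (μ i)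

/-! Recall -/

/-- The player's experience along the edges `s` followed from `h` on: the information sets visited
and the actions taken there. -/
def experienceFrom (G : SinglePlayerGame InfoSet Action) :
    List Action → List Action → List (InfoSet × Action)
  | _, [] => []
  | h, a :: s =>
    match G.infoSet h with
    | none => G.experienceFrom (h ++ [a]) s
    | some i => (i, a) :: G.experienceFrom (h ++ [a]) s

/-- Perfect recall: at any two nodes of the same information set, the player has had the same
experience since the root. -/
def HasPerfectRecall (G : SinglePlayerGame InfoSet Action) : Prop :=
  ∀ i, ∀ h ∈ G.infoNodes i, ∀ h' ∈ G.infoNodes i, G.experienceFrom [] h = G.experienceFrom [] h'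

end SinglePlayerGame

/-- The edge labels of the example game: the three chance outcomes at the root, and the actions
`a₁`, `a₂` of the player. -/
inductive Move
  | left
  | middle
  | right
  | a₁
  | a₂
deriving DecidableEq

instance : Fintype Move where
  elems := {Move.left, Move.middle, Move.right, Move.a₁, Move.a₂}
  complete := by intro x; cases x <;> decide

open Move in
/-- The example game. At the root, chance moves to one of three branches with probability `1/3`
each. In these branches the player decides up to six times, up to twice, and once, respectively;
each time `a₂` ends the game with utility `0`, and `a₁` leads on to the next decision node of the
branch, and finally to the terminal node of utility `-16`, `3`, `3`, respectively. All nine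
decision nodes belong to one single information set. -/
noncomputable def irrationalGame : SinglePlayerGame Unit Move where
  nodes :=
    { [],
      [left],
      [left, a₂],
      [left, a₁],
      [left, a₁, a₂],
      [left, a₁, a₁],
      [left, a₁, a₁, a₂],
      [left, a₁, a₁, a₁],
      [left, a₁, a₁, a₁, a₂],
      [left, a₁, a₁, a₁, a₁],
      [left, a₁, a₁, a₁, a₁, a₂],
      [left, a₁, a₁, a₁, a₁, a₁],
      [left, a₁, a₁, a₁, a₁, a₁, a₂],
      [left, a₁, a₁, a₁, a₁, a₁, a₁],
      [middle],
      [middle, a₂],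
      [middle, a₁],
      [middle, a₁, a₂],
      [middle, a₁, a₁],
      [right],
      [right, a₂],
      [right, a₁] }
  root_mem := by decide
  parent_mem := by
    intro h a hm
    simp only [Finset.mem_insert, Finset.mem_singleton] at hm
    have key : ∀ t : List Move, h ++ [a] = t → h = t.dropLast := by
      rintro t rfl; simp
    rcases hm with hm | hm | hm | hm | hm | hm | hm | hm | hm | hm | hm | hm | hm | hm | hm | hm |
      hm | hm | hm | hm | hm | hm <;>
      first | exact absurd hm (by simp) | (rw [key _ hm]; decide)
  infoSet h := if h = [] then none else some ()
  actions _ := {a₁, a₂}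
  actions_eq := by decide
  infoSet_nonempty := by
    intro i
    exact ⟨[left], by decide, ⟨a₁, by decide⟩, rfl⟩
  chanceProb _ _ := 1 / 3
  chanceProb_nonneg := by
    intros
    norm_num
  chanceProb_sum := by
    intro h _ _ hi
    have h0 : h = [] := by
      by_contra hne
      simp [hne] at hi
    subst h0
    rw [Finset.sum_const, show Finset.card _ = 3 from by decide]
    norm_num
  utility z :=
    if z = [left, a₁, a₁, a₁, a₁, a₁, a₁] then -16
    else if z = [middle, a₁, a₁] then 3
    else if z = [right, a₁] then 3
    else 0

/-- The strategy of the example game playing `a₁` with probability `x` and `a₂` with probability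
`1 - x` at the information set. -/
def mix (x : ℝ) : Unit → Move → ℝ
  | _, Move.a₁ => x
  | _, Move.a₂ => 1 - x
  | _, _ => 0

/-! With x the probability of `a₁`, everything depends on U(x) = -(16/3)x⁶ + x² + x. Its derivative
1 + 2x - 32x⁵ becomes -(t⁵ - t - 1) under x = t/2, so c = x*/2 is its only real zero.

Every play meets the single information set, so the EDT-GDH utility of α is U(α(a₁)) and its
equilibria are the ex-ante optima. The CDT-GT utility is linear in α(a₁), with slope U'(x) divided
by the positive visit frequency; as U'(0) > 0 > U'(1), equilibrium means U'(x) = 0. That c is the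
global maximum follows from an explicit second-order remainder (`sextic_lt_of_critical`).

For radicals, X⁵ - X - 1 is irreducible over ℚ, and modulo 2 it is (X² + X + 1)(X³ + X² + 1). A
Frobenius element at 2 thus has cycle type (2,3) on the roots, and its cube is a transposition. In
prime degree this forces the full group S₅, which is not solvable. -/

namespace SinglePlayerGame
open Move

/-! ### Closed forms for the example game -/

theorem irrationalGame_terminals : irrationalGame.terminals =
    { [left, a₂], [left, a₁, a₂], [left, a₁, a₁, a₂], [left, a₁, a₁, a₁, a₂],
      [left, a₁, a₁, a₁, a₁, a₂], [left, a₁, a₁, a₁, a₁, a₁, a₂],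
      [left, a₁, a₁, a₁, a₁, a₁, a₁], [middle, a₂], [middle, a₁, a₂], [middle, a₁, a₁],
      [right, a₂], [right, a₁] } := by
  decide

theorem irrationalGame_infoNodes : irrationalGame.infoNodes () =
    { [left], [left, a₁], [left, a₁, a₁], [left, a₁, a₁, a₁], [left, a₁, a₁, a₁, a₁],
      [left, a₁, a₁, a₁, a₁, a₁], [middle], [middle, a₁], [right] } := by
  decide

theorem irrationalGame_firstNodes :
    irrationalGame.firstNodes () = { [left], [middle], [right] } := by
  decide

theorem irrationalGame_expectedUtilityFrom (μ : Unit → Move → ℝ) (h : List Move) :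
    irrationalGame.expectedUtilityFrom μ h =
      irrationalGame.reachProb μ h [left, a₁, a₁, a₁, a₁, a₁, a₁] * -16 +
      irrationalGame.reachProb μ h [middle, a₁, a₁] * 3 +
      irrationalGame.reachProb μ h [right, a₁] * 3 := by
  rw [expectedUtilityFrom, irrationalGame_terminals]
  simp [irrationalGame, Finset.sum_insert, add_assoc]

theorem irrationalGame_moveProb_nil (μ : Unit → Move → ℝ) (a : Move) :
    irrationalGame.moveProb μ [] a = 1 / 3 := by
  simp [moveProb, irrationalGame]

theorem irrationalGame_moveProb_of_ne_nil (μ : Unit → Move → ℝ) {h : List Move} (hh : h ≠ [])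
    (a : Move) : irrationalGame.moveProb μ h a = μ () a := by
  simp [moveProb, irrationalGame, hh]

theorem irrationalGame_exAnteUtility (μ : Unit → Move → ℝ) :
    irrationalGame.exAnteUtility μ =
      -(16 / 3) * (μ () a₁) ^ 6 + (μ () a₁) ^ 2 + μ () a₁ := by
  rw [exAnteUtility, irrationalGame_expectedUtilityFrom]
  simp [reachProb, pathProb, irrationalGame_moveProb_nil, irrationalGame_moveProb_of_ne_nil]
  ring

theorem irrationalGame_visitFrequency (μ : Unit → Move → ℝ) :
    irrationalGame.visitFrequency μ () =
      1 / 3 * (3 + 2 * μ () a₁ + (μ () a₁) ^ 2 + (μ () a₁) ^ 3 + (μ () a₁) ^ 4 +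
        (μ () a₁) ^ 5) := by
  rw [visitFrequency, irrationalGame_infoNodes]
  simp [reachProb, pathProb, irrationalGame_moveProb_nil, irrationalGame_moveProb_of_ne_nil,
    Finset.sum_insert]
  ring

theorem irrationalGame_infoReachProb (μ : Unit → Move → ℝ) :
    irrationalGame.infoReachProb μ () = 1 := by
  rw [infoReachProb, irrationalGame_firstNodes]
  simp [reachProb, pathProb, irrationalGame_moveProb_nil, Finset.sum_insert]
  norm_num

theorem irrationalGame_utilityEDTGDH (α : Move → ℝ) (μ : Unit → Move → ℝ) :
    irrationalGame.utilityEDTGDH α μ () =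
      -(16 / 3) * (α a₁) ^ 6 + (α a₁) ^ 2 + α a₁ := by
  have key : irrationalGame.utilityEDTGDH α μ () =
      irrationalGame.exAnteUtility (Function.update μ () α) := by
    -- No terminal node avoids the information set, so no utility is lost by conditioning on it.
    have hvisit : ∀ z ∈ irrationalGame.terminals,
        ∃ h ∈ irrationalGame.infoNodes (), h <+: z := by
      rw [irrationalGame_terminals, irrationalGame_infoNodes]
      decide
    rw [utilityEDTGDH, exAnteUtility, expectedUtilityFrom]
    refine Finset.sum_congr rfl fun z hz ↦ ?_
    rw [beliefGDH, if_pos (hvisit z hz), irrationalGame_infoReachProb, div_one]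
  rw [key, irrationalGame_exAnteUtility]
  simp

/-- Deviating at one node at a time differentiates U by the product rule: `a₁` collects U', while
`a₂` ends the game with 0. -/
theorem irrationalGame_utilityCDTGT (α : Move → ℝ) (μ : Unit → Move → ℝ) :
    irrationalGame.utilityCDTGT α μ () =
      α a₁ * ((1 + 2 * μ () a₁ - 32 * (μ () a₁) ^ 5) / irrationalGame.visitFrequency μ ()) := by
  have hbelief : ∀ a, irrationalGame.actionUtilityCDTGT a μ () =
      (∑ h ∈ irrationalGame.infoNodes (), irrationalGame.reachProb μ [] h *
        irrationalGame.expectedUtilityFrom μ (h ++ [a])) /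
          irrationalGame.visitFrequency μ () := by
    intro a
    rw [actionUtilityCDTGT, Finset.sum_div]
    refine Finset.sum_congr rfl fun h hh ↦ ?_
    rw [beliefGT, if_pos hh]
    ring
  have hactions : irrationalGame.actions () = {a₁, a₂} := rfl
  rw [utilityCDTGT, hactions, Finset.sum_pair (by decide), hbelief, hbelief,
    irrationalGame_infoNodes]
  simp only [irrationalGame_expectedUtilityFrom]
  have h₁ : (∑ h ∈ ({ [left], [left, a₁], [left, a₁, a₁], [left, a₁, a₁, a₁],
      [left, a₁, a₁, a₁, a₁], [left, a₁, a₁, a₁, a₁, a₁], [middle], [middle, a₁],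
      [right] } : Finset (List Move)), irrationalGame.reachProb μ [] h *
        (irrationalGame.reachProb μ (h ++ [a₁]) [left, a₁, a₁, a₁, a₁, a₁, a₁] * -16 +
          irrationalGame.reachProb μ (h ++ [a₁]) [middle, a₁, a₁] * 3 +
          irrationalGame.reachProb μ (h ++ [a₁]) [right, a₁] * 3)) =
      1 + 2 * μ () a₁ - 32 * (μ () a₁) ^ 5 := by
    simp [reachProb, pathProb, irrationalGame_moveProb_nil, irrationalGame_moveProb_of_ne_nil,
      Finset.sum_insert]
    ring
  have h₂ : (∑ h ∈ ({ [left], [left, a₁], [left, a₁, a₁], [left, a₁, a₁, a₁],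
      [left, a₁, a₁, a₁, a₁], [left, a₁, a₁, a₁, a₁, a₁], [middle], [middle, a₁],
      [right] } : Finset (List Move)), irrationalGame.reachProb μ [] h *
        (irrationalGame.reachProb μ (h ++ [a₂]) [left, a₁, a₁, a₁, a₁, a₁, a₁] * -16 +
          irrationalGame.reachProb μ (h ++ [a₂]) [middle, a₁, a₁] * 3 +
          irrationalGame.reachProb μ (h ++ [a₂]) [right, a₁] * 3)) = 0 := by
    simp [reachProb, Finset.sum_insert]
  rw [h₁, h₂]
  ring

theorem not_hasPerfectRecall_irrationalGame : ¬ irrationalGame.HasPerfectRecall := by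
  intro h
  have := h () [left] (by decide) [left, a₁] (by decide)
  simp [experienceFrom, irrationalGame] at this

theorem mem_mixedActions_irrationalGame {α : Move → ℝ} :
    α ∈ irrationalGame.mixedActions () ↔ ∃ x, 0 ≤ x ∧ x ≤ 1 ∧ α = mix x () := by
  have hactions : irrationalGame.actions () = {a₁, a₂} := rfl
  rw [mixedActions, Set.mem_ofPred_eq, hactions, Finset.sum_pair (by decide)]
  constructor
  · rintro ⟨hnonneg, hzero, hsum⟩
    refine ⟨α a₁, hnonneg _, by linarith [hnonneg a₂], ?_⟩
    funext a
    cases a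
    case a₁ => rfl
    case a₂ => simp only [mix]; linarith
    all_goals exact hzero _ (by decide)
  · rintro ⟨x, h0, h1, rfl⟩
    refine ⟨fun a ↦ ?_, fun a ha ↦ ?_, by simp [mix]⟩
    · cases a <;> simp [mix, h0, h1]
    · cases a <;> simp_all [mix]

theorem mem_strategies_irrationalGame {μ : Unit → Move → ℝ} :
    μ ∈ irrationalGame.strategies ↔ ∃ x, 0 ≤ x ∧ x ≤ 1 ∧ μ = mix x := by
  have : μ ∈ irrationalGame.strategies ↔ μ () ∈ irrationalGame.mixedActions () :=
    ⟨fun h ↦ h (), fun h _ ↦ h⟩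
  rw [this, mem_mixedActions_irrationalGame]
  exact exists_congr fun x ↦ and_congr_right' <| and_congr_right' <|
    Unique.forall_iff.symm.trans funext_iff.symm

end SinglePlayerGame

/-! ### The Galois group of X⁵ - X - 1 -/

section QuinticGaloisGroup

open Polynomial NumberField

namespace Polynomial.Gal

open scoped Classical in
/-- An irreducible rational polynomial of prime degree whose Galois group contains a transposition
of the roots has full Galois group. -/
theorem galActionHom_bijective_of_isSwap {p : ℚ[X]} (p_irr : Irreducible p)
    (p_deg : p.natDegree.Prime) {E : Type*} [Field E] [Algebra ℚ E]
    [hp : Fact ((p.map (algebraMap ℚ E)).Splits)] {σ : p.Gal}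
    (hσ : (galActionHom p E σ).IsSwap) : Function.Bijective (galActionHom p E) := by
  have hcard : Fintype.card (p.rootSet E) = p.natDegree :=
    card_rootSet_eq_natDegree p_irr.separable hp.out
  refine ⟨galActionHom_injective p E, MonoidHom.range_eq_top.mp ?_⟩
  apply Equiv.Perm.subgroup_eq_top_of_swap_mem (τ := galActionHom p E σ)
  · rwa [hcard]
  · rw [hcard]
    -- Adjoining one root shows that the prime degree divides the group order.
    simpa only [Fintype.card_eq_nat_card,
      Nat.card_congr (MonoidHom.ofInjective (galActionHom_injective p E)).toEquiv.symm]
      using prime_degree_dvd_card p_irr p_deg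
  · exact ⟨σ, rfl⟩
  · exact hσ

end Polynomial.Gal

/-- A Galois number field has a Frobenius element at some prime above `2`. -/
theorem NumberField.exists_frobenius_two (K : Type*) [Field K] [NumberField K] [IsGalois ℚ K] :
    ∃ Q : Ideal (𝓞 K), Q.IsMaximal ∧ (2 : 𝓞 K) ∈ Q ∧
      ∃ σ : Gal(K/ℚ), ∀ x : 𝓞 K, σ • x - x ^ 2 ∈ Q := by
  have : (Ideal.span {((2 : ℕ) : ℤ)}).IsMaximal :=
    Int.ideal_span_isMaximal_of_prime 2
  obtain ⟨Q, hQ, hover⟩ := Ideal.exists_maximal_ideal_liesOver_of_isIntegral (S := 𝓞 K)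
    (Ideal.span {((2 : ℕ) : ℤ)})
  have hunder : Q.under ℤ = Ideal.span {((2 : ℕ) : ℤ)} := hover.over.symm
  refine ⟨Q, hQ, ?_, ?_⟩
  · have h2 : (2 : ℤ) ∈ Q.under ℤ := hunder ▸ Ideal.mem_span_singleton_self _
    simpa [Ideal.under, Ideal.mem_comap] using h2
  · have := IsGaloisGroup.isInvariant (G := Gal(K/ℚ)) (A := ℤ) (B := 𝓞 K)
    obtain ⟨σ, hσ⟩ := IsArithFrobAt.exists_of_isInvariant ℤ Gal(K/ℚ) Q
    refine ⟨σ, fun x ↦ ?_⟩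
    have := hσ x
    -- The Frobenius exponent is the size of ℤ/2.
    rwa [hunder, Int.card_ideal_quot] at this

section CharTwo

variable {k : Type*} [Field k] [CharP k 2]

theorem CharTwo.root_of_quintic_cases {a : k} (ha : a ^ 5 - a - 1 = 0) :
    a ^ 2 + a + 1 = 0 ∨ a ^ 3 + a ^ 2 + 1 = 0 := by
  have h2 : (2 : k) = 0 := CharTwo.two_eq_zero
  rw [← mul_eq_zero]
  linear_combination ha + (a ^ 4 + a ^ 3 + a ^ 2 + a + 1) * h2

/-- Here a³ = 1, so the cube of Frobenius sends a to a² = a + 1, the other root. -/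
theorem CharTwo.pow_eight_of_quadratic {a : k} (ha : a ^ 2 + a + 1 = 0) : a ^ 8 = a + 1 := by
  have h2 : (2 : k) = 0 := CharTwo.two_eq_zero
  have h3 : a ^ 3 = 1 := by linear_combination (a - 1) * ha
  linear_combination (a ^ 5 + a ^ 2) * h3 + ha - (a + 1) * h2

/-- Such a lies in 𝔽₈, which the cube of Frobenius fixes. -/
theorem CharTwo.pow_eight_of_cubic {a : k} (ha : a ^ 3 + a ^ 2 + 1 = 0) : a ^ 8 = a := by
  have h2 : (2 : k) = 0 := CharTwo.two_eq_zero
  linear_combination (a ^ 5 - a ^ 4 + a ^ 3 - 2 * a ^ 2 + 3 * a - 4) * ha +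
    (3 * a ^ 2 - 2 * a + 2) * h2

theorem CharTwo.quadratic_add_one {a : k} (ha : a ^ 2 + a + 1 = 0) :
    (a + 1) ^ 2 + (a + 1) + 1 = 0 := by
  have h2 : (2 : k) = 0 := CharTwo.two_eq_zero
  linear_combination ha + (a + 1) * h2

theorem CharTwo.eq_or_eq_of_quadratic {a b : k} (ha : a ^ 2 + a + 1 = 0)
    (hb : b ^ 2 + b + 1 = 0) : b = a ∨ b = a + 1 := by
  have h2 : (2 : k) = 0 := CharTwo.two_eq_zero
  rw [← sub_eq_zero, ← sub_eq_zero (a := b) (b := a + 1), ← mul_eq_zero]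
  linear_combination hb + ha - (a * b + b + 1) * h2

end CharTwo

/-- Distinct roots of `X ^ 5 - X - 1` stay distinct under reduction to characteristic two. -/
theorem reduction_injective_of_quintic {R k : Type*} [CommRing R] [IsDomain R] [Field k]
    [CharP k 2] (f : R →+* k) {r s : R} (hr : r ^ 5 - r - 1 = 0) (hs : s ^ 5 - s - 1 = 0)
    (h : f r = f s) : r = s := by
  by_contra hne
  have hquot : r ^ 4 + r ^ 3 * s + r ^ 2 * s ^ 2 + r * s ^ 3 + s ^ 4 - 1 = 0 := by
    refine (mul_eq_zero.mp ?_).resolve_left (sub_ne_zero.mpr hne)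
    linear_combination hr - hs
  have hquot' := congrArg f hquot
  have hr' := congrArg f hr
  simp only [map_add, map_sub, map_mul, map_pow, map_one, map_zero, ← h] at hquot' hr'
  have h2 : (2 : k) = 0 := CharTwo.two_eq_zero
  have : (1 : k) = 0 := by
    -- If the reductions agree, `hquot'` says that the derivative 5X⁴ - 1 vanishes there too, but
    -- the quintic is separable modulo 2.
    linear_combination f r * hquot' - hr' - 2 * f r ^ 5 * h2
  exact one_ne_zero this

theorem natDegree_X_pow_five_sub_X_sub_one : (X ^ 5 - X - 1 : ℚ[X]).natDegree = 5 := by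
  compute_degree!

open scoped Classical in
/-- Modulo `2` the polynomial `X ^ 5 - X - 1` is a product of irreducible factors of degrees `2` and
`3`, so the cube of a Frobenius element at `2` is a transposition of the roots. -/
theorem exists_isSwap_galActionHom_quintic (K : Type*) [Field K] [NumberField K] [IsGalois ℚ K]
    [hsplit : Fact (((X ^ 5 - X - 1 : ℚ[X]).map (algebraMap ℚ K)).Splits)] :
    ∃ σ : (X ^ 5 - X - 1 : ℚ[X]).Gal, (Gal.galActionHom (X ^ 5 - X - 1) K σ).IsSwap := by
  obtain ⟨Q, hQ, h2Q, σ, hσ⟩ := NumberField.exists_frobenius_two K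
  let k := 𝓞 K ⧸ Q
  let _ : Field k := Ideal.Quotient.field Q
  let π : 𝓞 K →+* k := Ideal.Quotient.mk Q
  have hchar : CharP k 2 := by
    refine CharTwo.of_one_ne_zero_of_two_eq_zero one_ne_zero ?_
    have : π 2 = 0 := Ideal.Quotient.eq_zero_iff_mem.mpr h2Q
    rwa [map_ofNat] at this
  have hπσ : ∀ x, π (σ • x) = π x ^ 2 := fun x ↦ by
    rw [← map_pow]
    exact Ideal.Quotient.eq.mpr (hσ x)
  have hπσ3 : ∀ x, π (σ ^ 3 • x) = π x ^ 8 := fun x ↦ by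
    rw [pow_succ, pow_two, mul_smul, mul_smul, hπσ, hπσ, hπσ]
    ring
  have hirr : Irreducible (X ^ 5 - X - 1 : ℚ[X]) :=
    X_pow_sub_X_sub_one_irreducible_rat (by norm_num)
  have hroot : ∀ r : (X ^ 5 - X - 1 : ℚ[X]).rootSet K, (r : K) ^ 5 - r - 1 = 0 := fun r ↦ by
    simpa using aeval_eq_zero_of_mem_rootSet r.2
  have hint : ∀ r : (X ^ 5 - X - 1 : ℚ[X]).rootSet K, IsIntegral ℤ (r : K) := fun r ↦
    ⟨X ^ 5 - X - 1, by monicity!, by simpa [eval₂_sub] using hroot r⟩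
  let ρ : (X ^ 5 - X - 1 : ℚ[X]).rootSet K → 𝓞 K := fun r ↦ ⟨r, hint r⟩
  have hρ : ∀ r, ρ r ^ 5 - ρ r - 1 = 0 := fun r ↦ RingOfIntegers.ext <| by
    simp only [map_sub, map_pow, map_one, map_zero]
    exact hroot r
  have hρinj : Function.Injective ρ := fun r s h ↦
    Subtype.ext (congrArg (algebraMap (𝓞 K) K) h)
  have hredinj : Function.Injective (fun r ↦ π (ρ r)) := fun r s h ↦
    hρinj (reduction_injective_of_quintic π (hρ r) (hρ s) h)
  have hred : ∀ r, π (ρ r) ^ 5 - π (ρ r) - 1 = 0 := fun r ↦ by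
    simpa using congrArg π (hρ r)
  let τ := Gal.galActionHom (X ^ 5 - X - 1) K (Gal.restrict _ K (σ ^ 3))
  have hτ : ∀ r, π (ρ (τ r)) = π (ρ r) ^ 8 := fun r ↦ by
    rw [← hπσ3]
    congr 1
    exact RingOfIntegers.ext (Gal.galActionHom_restrict _ K (σ ^ 3) r)
  -- Otherwise five distinct reductions would be roots of the cubic factor.
  obtain ⟨i, hi⟩ : ∃ i, π (ρ i) ^ 2 + π (ρ i) + 1 = 0 := by
    by_contra! hne
    have hcubic : ∀ r, π (ρ r) ^ 3 + π (ρ r) ^ 2 + 1 = 0 := fun r ↦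
      (CharTwo.root_of_quintic_cases (hred r)).resolve_left (hne r)
    let q : k[X] := X ^ 3 + X ^ 2 + 1
    have hq : q.natDegree = 3 := by unfold q; compute_degree!
    have hq0 : q ≠ 0 := ne_zero_of_natDegree_gt (n := 0) (by omega)
    have hle : Fintype.card ((X ^ 5 - X - 1 : ℚ[X]).rootSet K) ≤ q.roots.toFinset.card := by
      rw [← Finset.card_univ]
      refine Finset.card_le_card_of_injOn _ (fun r _ ↦ ?_) hredinj.injOn
      simpa [hq0, q] using hcubic r
    rw [card_rootSet_eq_natDegree hirr.separable hsplit.out,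
      natDegree_X_pow_five_sub_X_sub_one] at hle
    have := hle.trans ((Multiset.toFinset_card_le _).trans (card_roots' q))
    omega
  have hτi : π (ρ (τ i)) = π (ρ i) + 1 := by
    rw [hτ, CharTwo.pow_eight_of_quadratic hi]
  suffices hswap : τ.IsSwap from ⟨_, hswap⟩
  refine ⟨i, τ i, ?_, ?_⟩
  · intro h
    rw [← h] at hτi
    simp at hτi
  · ext1 l
    rcases eq_or_ne l i with rfl | hli
    · rw [Equiv.swap_apply_left]
    rcases eq_or_ne l (τ i) with rfl | hlj
    · rw [Equiv.swap_apply_right]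
      apply hredinj
      change π (ρ (τ (τ i))) = π (ρ i)
      rw [hτ, hτi, CharTwo.pow_eight_of_quadratic (CharTwo.quadratic_add_one hi), add_assoc,
        CharTwo.add_self_eq_zero, add_zero]
    rw [Equiv.swap_apply_of_ne_of_ne hli hlj]
    apply hredinj
    change π (ρ (τ l)) = π (ρ l)
    rw [hτ]
    refine CharTwo.pow_eight_of_cubic
      ((CharTwo.root_of_quintic_cases (hred l)).resolve_left fun hl ↦ ?_)
    rcases CharTwo.eq_or_eq_of_quadratic hi hl with h | h
    · exact hli (hredinj h)
    · exact hlj (hredinj (h.trans hτi.symm))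

/-- The splitting field of a rational polynomial, with its structure of a field of characteristic
zero as its only `ℚ`-algebra structure. -/
theorem exists_numberField_isSplittingField (f : ℚ[X]) :
    ∃ (K : Type) (_ : Field K) (_ : NumberField K), IsSplittingField ℚ K f := by
  -- `NumberField` uses the ℚ-algebra structure from characteristic zero; it equals that of
  -- `SplittingField` by uniqueness.
  have hsplit : @IsSplittingField ℚ f.SplittingField _ _ DivisionRing.toRatAlgebra f := by
    convert! IsSplittingField.splittingField f
  refine ⟨f.SplittingField, inferInstance, ?_, hsplit⟩
  exact { to_charZero := inferInstance
          to_finiteDimensional := @IsSplittingField.finiteDimensional ℚ f.SplittingField _ _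
            DivisionRing.toRatAlgebra f hsplit }

theorem not_isSolvable_gal_quintic : ¬ Group.IsSolvable (X ^ 5 - X - 1 : ℚ[X]).Gal := by
  classical
  intro hsolv
  obtain ⟨K, _, _, hK⟩ := exists_numberField_isSplittingField (X ^ 5 - X - 1)
  have hirr : Irreducible (X ^ 5 - X - 1 : ℚ[X]) :=
    X_pow_sub_X_sub_one_irreducible_rat (by norm_num)
  have hdeg := natDegree_X_pow_five_sub_X_sub_one
  have : IsGalois ℚ K := IsGalois.of_separable_splitting_field hirr.separable
  have hsplit : Fact (((X ^ 5 - X - 1 : ℚ[X]).map (algebraMap ℚ K)).Splits) := ⟨hK.splits'⟩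
  obtain ⟨σ, hσ⟩ := exists_isSwap_galActionHom_quintic K
  have hbij := Gal.galActionHom_bijective_of_isSwap hirr (by rw [hdeg]; norm_num) hσ
  refine Equiv.Perm.not_isSolvable ((X ^ 5 - X - 1 : ℚ[X]).rootSet K) ?_
    (Group.isSolvable_of_surjective hbij.surjective)
  rw [Cardinal.mk_fintype, card_rootSet_eq_natDegree hirr.separable hsplit.out, hdeg]
  norm_num

theorem notMem_solvableByRad_of_quintic {x : ℂ} (hx : x ^ 5 - x - 1 = 0) :
    x ∉ solvableByRad ℚ ℂ := fun h ↦
  not_isSolvable_gal_quintic (isSolvable_gal_of_irreducible h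
    (X_pow_sub_X_sub_one_irreducible_rat (by norm_num)) (by simpa using hx))

end QuinticGaloisGroup

/-! ### The real root and the maximum of U -/

theorem exists_unique_real_root_quintic :
    ∃ c : ℝ, 1 < c ∧ c < 2 ∧ ∀ x : ℝ, x ^ 5 - x - 1 = 0 ↔ x = c := by
  obtain ⟨c, ⟨hc1, hc2⟩, hc⟩ : ∃ c ∈ Set.Icc (1 : ℝ) 2, c ^ 5 - c - 1 = 0 := by
    have := intermediate_value_Icc (one_le_two (α := ℝ))
      (f := fun x : ℝ ↦ x ^ 5 - x - 1) (by fun_prop)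
    exact this ⟨by norm_num, by norm_num⟩
  refine ⟨c, hc1.lt_of_ne ?_, hc2.lt_of_ne ?_, fun x ↦ ⟨fun hx ↦ ?_, fun h ↦ h ▸ hc⟩⟩
  · rintro rfl; norm_num at hc
  · rintro rfl; norm_num at hc
  -- On [0,1] one has x⁵ ≤ x, and for x ≤ 0 still x⁵ - x < 1.
  have hx1 : 1 < x := by
    by_contra! hle
    rcases le_total 0 x with h0 | h0
    · linarith [pow_le_of_le_one h0 hle (n := 5) (by norm_num)]
    · nlinarith [sq_nonneg (x ^ 2), sq_nonneg (x * (x ^ 2 - 1)), sq_nonneg (x ^ 2 - 1),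
        sq_nonneg x, sq_nonneg (x + 1)]
  -- The second factor is positive because x⁴ > 1.
  have hmul : (x - c) * (x ^ 4 + x ^ 3 * c + x ^ 2 * c ^ 2 + x * c ^ 3 + c ^ 4 - 1) = 0 := by
    linear_combination hx - hc
  refine sub_eq_zero.mp ((mul_eq_zero.mp hmul).resolve_right (ne_of_gt ?_))
  have : 1 < x ^ 4 := one_lt_pow₀ hx1 (by norm_num)
  have : 0 < x := by linarith
  have : 0 < c := by linarith
  have : 0 < x ^ 3 * c + x ^ 2 * c ^ 2 + x * c ^ 3 + c ^ 4 := by positivity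
  linarith

theorem quintic_div_two_eq_iff {c : ℝ} (hc : ∀ x : ℝ, x ^ 5 - x - 1 = 0 ↔ x = c) (x : ℝ) :
    1 + 2 * x - 32 * x ^ 5 = 0 ↔ x = c / 2 := by
  rw [eq_div_iff two_ne_zero, mul_comm, ← hc]
  constructor <;> intro h <;> linear_combination -h

/-- U is not concave near 0, so the remainder is used: U(c) - U(x) is (x - c)² times the factor in
`hfac`, whose term (80/3)c⁴ alone exceeds 1. -/
theorem sextic_lt_of_critical {c x : ℝ} (hc : 1 + 2 * c - 32 * c ^ 5 = 0) (hc0 : 1 < 2 * c)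
    (hx : 0 ≤ x) (hne : x ≠ c) :
    -(16 / 3) * x ^ 6 + x ^ 2 + x < -(16 / 3) * c ^ 6 + c ^ 2 + c := by
  have hpos : 0 < (x - c) ^ 2 := by
    have := sub_ne_zero.mpr hne
    positivity
  have h4 : 1 < 16 * c ^ 4 := by
    have : 1 < (2 * c) ^ 4 := one_lt_pow₀ hc0 (by norm_num)
    linarith [mul_pow 2 c 4]
  have hc' : 0 < c := by linarith
  have hfac : 0 < 16 / 3 * (x ^ 4 + 2 * x ^ 3 * c + 3 * x ^ 2 * c ^ 2 + 4 * x * c ^ 3 +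
      5 * c ^ 4) - 1 := by
    have : 0 ≤ x ^ 4 + 2 * x ^ 3 * c + 3 * x ^ 2 * c ^ 2 + 4 * x * c ^ 3 := by positivity
    linarith
  have := mul_pos hpos hfac
  linear_combination this + (x - c) * hc

/-! ### Optimal strategies and equilibria -/

namespace SinglePlayerGame

open Move

theorem mix_mem_mixedActions {x : ℝ} (h0 : 0 ≤ x) (h1 : x ≤ 1) :
    mix x () ∈ irrationalGame.mixedActions () :=
  mem_mixedActions_irrationalGame.mpr ⟨x, h0, h1, rfl⟩

theorem mix_mem_strategies {x : ℝ} (h0 : 0 ≤ x) (h1 : x ≤ 1) :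
    mix x ∈ irrationalGame.strategies :=
  mem_strategies_irrationalGame.mpr ⟨x, h0, h1, rfl⟩

theorem isExAnteOptimal_iff_isEDTGDHEquilibrium (μ : Unit → Move → ℝ) :
    irrationalGame.IsExAnteOptimal μ ↔ irrationalGame.IsEDTGDHEquilibrium μ := by
  refine and_congr_right fun _ ↦ ⟨fun h ⟨⟩ _ α hα ↦ ?_, fun h ν hν ↦ ?_⟩
  · have := h (show (fun _ ↦ α) ∈ irrationalGame.strategies from fun _ ↦ hα)
    simpa only [Set.mem_ofPred_eq, irrationalGame_exAnteUtility, irrationalGame_utilityEDTGDH]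
      using this
  · have := h () (by rw [irrationalGame_infoReachProb]; exact one_pos) (hν ())
    simpa only [Set.mem_ofPred_eq, irrationalGame_exAnteUtility, irrationalGame_utilityEDTGDH]
      using this

theorem isExAnteOptimal_iff_eq_mix {c : ℝ} (hc : 1 + 2 * c - 32 * c ^ 5 = 0) (hc0 : 1 < 2 * c)
    (hc1 : c ≤ 1) (μ : Unit → Move → ℝ) : irrationalGame.IsExAnteOptimal μ ↔ μ = mix c := by
  constructor
  · rintro ⟨hμ, hmax⟩
    obtain ⟨x, hx0, -, rfl⟩ := mem_strategies_irrationalGame.mp hμ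
    by_contra hne
    have hle := hmax (mix_mem_strategies (by linarith : 0 ≤ c) hc1)
    simp only [Set.mem_ofPred_eq, irrationalGame_exAnteUtility, mix] at hle
    exact absurd hle (sextic_lt_of_critical hc hc0 hx0 fun h ↦ hne (h ▸ rfl)).not_ge
  · rintro rfl
    refine ⟨mix_mem_strategies (by linarith) hc1, fun ν hν ↦ ?_⟩
    obtain ⟨x, hx0, -, rfl⟩ := mem_strategies_irrationalGame.mp hν
    simp only [Set.mem_ofPred_eq, irrationalGame_exAnteUtility, mix]
    rcases eq_or_ne x c with rfl | hne
    · exact le_rfl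
    · exact (sextic_lt_of_critical hc hc0 hx0 hne).le

theorem isCDTGTEquilibrium_iff_eq_mix {c : ℝ}
    (hc : ∀ x : ℝ, 1 + 2 * x - 32 * x ^ 5 = 0 ↔ x = c) (hc0 : 0 ≤ c) (hc1 : c ≤ 1)
    (μ : Unit → Move → ℝ) : irrationalGame.IsCDTGTEquilibrium μ ↔ μ = mix c := by
  constructor
  · rintro ⟨hμ, heq⟩
    obtain ⟨x, hx0, hx1, rfl⟩ := mem_strategies_irrationalGame.mp hμ
    have hfreq : 0 < irrationalGame.visitFrequency (mix x) () := by
      rw [irrationalGame_visitFrequency]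
      simp only [mix]
      positivity
    have hmax : ∀ y, 0 ≤ y → y ≤ 1 →
        y * (1 + 2 * x - 32 * x ^ 5) ≤ x * (1 + 2 * x - 32 * x ^ 5) := by
      intro y hy0 hy1
      have hle := heq () hfreq (mix_mem_mixedActions hy0 hy1)
      simp only [Set.mem_ofPred_eq, irrationalGame_utilityCDTGT, mix] at hle
      rwa [← mul_div_assoc, ← mul_div_assoc, div_le_div_iff_of_pos_right hfreq] at hle
    -- The slope is 1 at x = 0 and -29 at x = 1, so both pure strategies invite a deviation.
    have hx0' : x ≠ 0 := by
      rintro rfl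
      linarith [hmax 1 zero_le_one le_rfl]
    have hx1' : x ≠ 1 := by
      rintro rfl
      linarith [hmax 0 le_rfl zero_le_one]
    have hpos : 0 < x := hx0.lt_of_ne' hx0'
    have hlt : x < 1 := hx1.lt_of_ne hx1'
    -- For interior x, deviating to y = 1 and to y = 0 bounds the slope from both sides.
    have hle : 1 + 2 * x - 32 * x ^ 5 ≤ 0 := by
      nlinarith [hmax 1 zero_le_one le_rfl]
    have hge : 0 ≤ 1 + 2 * x - 32 * x ^ 5 := by
      nlinarith [hmax 0 le_rfl zero_le_one]
    rw [(hc x).mp (le_antisymm hle hge)]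
  · rintro rfl
    refine ⟨mix_mem_strategies hc0 hc1, fun ⟨⟩ _ α _ ↦ ?_⟩
    have hcrit : 1 + 2 * mix c () a₁ - 32 * mix c () a₁ ^ 5 = 0 := (hc c).mpr rfl
    simp only [Set.mem_ofPred_eq, irrationalGame_utilityCDTGT, hcrit, zero_div, mul_zero, le_rfl]

end SinglePlayerGame

/-! ### Irrationality and the main theorem -/

theorem irrational_of_notMem_solvableByRad {x : ℝ} (hx : (x : ℂ) ∉ solvableByRad ℚ ℂ) :
    Irrational x := by
  rintro ⟨q, rfl⟩
  exact hx (by simp)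

theorem mainTheorem7 :
    ¬ irrationalGame.HasPerfectRecall ∧
    (∀ μ : Unit → Move → ℝ, irrationalGame.exAnteUtility μ =
      -(16 / 3) * (μ () Move.a₁) ^ 6 + (μ () Move.a₁) ^ 2 + μ () Move.a₁) ∧
    ∃ xstar : ℝ,
      (∀ x : ℝ, x ^ 5 - x - 1 = 0 ↔ x = xstar) ∧
      (∀ μ, irrationalGame.IsExAnteOptimal μ ↔ μ = mix (xstar / 2)) ∧
      (∀ μ, irrationalGame.IsEDTGDHEquilibrium μ ↔ μ = mix (xstar / 2)) ∧
      (∀ μ, irrationalGame.IsCDTGTEquilibrium μ ↔ μ = mix (xstar / 2)) ∧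
      Irrational (xstar / 2) ∧ Irrational (1 - xstar / 2) ∧
      ((xstar / 2 : ℝ) : ℂ) ∉ solvableByRad ℚ ℂ ∧
      ((1 - xstar / 2 : ℝ) : ℂ) ∉ solvableByRad ℚ ℂ := by
  obtain ⟨c, hc1, hc2, hc⟩ := exists_unique_real_root_quintic
  have hcrit := quintic_div_two_eq_iff hc
  have hopt := SinglePlayerGame.isExAnteOptimal_iff_eq_mix ((hcrit (c / 2)).mpr rfl)
    (by linarith) (by linarith)
  have hrad : (c : ℂ) ∉ solvableByRad ℚ ℂ :=
    notMem_solvableByRad_of_quintic (by exact_mod_cast (hc c).mpr rfl)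
  have hrad₁ : ((c / 2 : ℝ) : ℂ) ∉ solvableByRad ℚ ℂ := fun h ↦ hrad <| by
    have := mul_mem h (ofNat_mem (solvableByRad ℚ ℂ) 2)
    simpa using this
  have hrad₂ : ((1 - c / 2 : ℝ) : ℂ) ∉ solvableByRad ℚ ℂ := fun h ↦ hrad₁ <| by
    have := sub_mem (one_mem (solvableByRad ℚ ℂ)) h
    simpa using this
  exact ⟨SinglePlayerGame.not_hasPerfectRecall_irrationalGame,
    SinglePlayerGame.irrationalGame_exAnteUtility, c, hc, hopt,
    fun μ ↦ (SinglePlayerGame.isExAnteOptimal_iff_isEDTGDHEquilibrium μ).symm.trans (hopt μ),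
    SinglePlayerGame.isCDTGTEquilibrium_iff_eq_mix hcrit (by linarith) (by linarith),
    irrational_of_notMem_solvableByRad hrad₁, irrational_of_notMem_solvableByRad hrad₂,
    hrad₁, hrad₂⟩
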